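/- A \emph{linear triple system} is a 3-uniform hypergraph in which any two distinct points lie in at most one common block; a \emph{configuration} is a linear triple system in which every point lies in at least one block. A \emph{Steiner triple system} is a linear triple system in which any two distinct points lie in exactly one block. Let $s\ge 1$. An \emph{$s$-pattern} is a finite properly edge-coloured forest that is the union of pairwise edge-disjoint matchings $M^1,\dots,M^s$ (the colour classes) such that for every $1\le i\le s$ every edge of $M^i$ has an endpoint that is not covered by any edge of any $M^j$ with $i<j\le s$. An \emph{extended $s$-pattern} is obtained from a disconnected $s$-pattern by joining two of its connected components by a single edge, which forms a matching $M^*$ of a new colour. An \emph{extended $s$-configuration} is a configuration isomorphic to one obtained from an extended $s$-pattern as follows: for each colour class $M\in\{M^1,\dots,M^s,M^*\}$ take a new point $v_M$ (these points are distinct from each other and from all vertices of the pattern) and replace every edge $e\in M$ by the block $e\cup\{v_M\}$; the points of the configuration are the points covered by these blocks. A configuration $C$ is \emph{$t$-Ramsey} if there is $n_0=n_0(C,t)$ such that for every Steiner triple system on a finite set of $n\ge n_0$ points and every colouring of its blocks with $t$ colours there is a monochromatic copy of $C$, i.e. an injective map from the points of $C$ to the points of the system that maps all blocks of $C$ to blocks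 of one and the same colour. \textbf{Theorem.} For all integers $s,t\ge 1$, every extended $s$-configuration is $t$-Ramsey. -/

import Mathlib

universe u v

/-- A linear 3-uniform hypergraph (linear triple system) on the point set `V`: the blocks are
3-element sets, and any two distinct points lie in at most one common block. -/
structure LinearTripleSystem (V : Type u) where
  blocks : Set (Finset V)
  card_eq_three : ∀ B ∈ blocks, B.card = 3
  linear : ∀ B ∈ blocks, ∀ B' ∈ blocks, ∀ x y : V, x ≠ y →
    x ∈ B → y ∈ B → x ∈ B' → y ∈ B' → B = B'

/-- A configuration: a linear triple system in which every point is in at least one block. -/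
structure TripleConfiguration (V : Type u) extends LinearTripleSystem V where
  covered : ∀ x : V, ∃ B ∈ blocks, x ∈ B

/-- A Steiner triple system: any two distinct points lie in exactly one common block
(at most one by linearity, at least one by `exists_block`). -/
structure SteinerTripleSystem (V : Type u) extends LinearTripleSystem V where
  exists_block : ∀ x y : V, x ≠ y → ∃ B ∈ blocks, x ∈ B ∧ y ∈ B

/-- The graphs `M 0, …, M (s - 1)` are the colour classes, in this order, of an `s`-pattern:
they are pairwise edge-disjoint matchings, their union is a forest, and every edge of `M i` has an
endpoint that is not covered by any edge of any later matching `M j`, `i < j`. -/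
structure IsPattern {W : Type u} {s : ℕ} (M : Fin s → SimpleGraph W) : Prop where
  matching : ∀ i x y z, (M i).Adj x y → (M i).Adj x z → y = z
  edge_disjoint : ∀ i j, i ≠ j → ∀ x y, (M i).Adj x y → ¬ (M j).Adj x y
  acyclic : (⨆ i, M i).IsAcyclic
  free_endpoint : ∀ i x y, (M i).Adj x y →
    ∃ w, (w = x ∨ w = y) ∧ ∀ j, i < j → ∀ z, ¬ (M j).Adj w z

/-- The colour classes `N (some 0), …, N (some (s - 1)), N none` form an extended `s`-pattern:
the `N (some i)` form an `s`-pattern, and `N none` consists of a single edge, which joins two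
different connected components of that pattern. -/
def IsExtendedPattern {W : Type u} {s : ℕ} (N : Option (Fin s) → SimpleGraph W) : Prop :=
  IsPattern (fun i => N (some i)) ∧
    ∃ p q : W, ¬ (⨆ i, N (some i)).Reachable p q ∧ N none = SimpleGraph.edge p q

/-- The triples obtained from a graph with colour classes `N k` by adding to each edge of colour
`k` the augmenting point of that colour; the augmenting points `Sum.inr k` are distinct from each
other and from the vertices `Sum.inl x`. -/
def augmentedBlocks {W K : Type*} [DecidableEq W] [DecidableEq K] (N : K → SimpleGraph W) :
    Set (Finset (W ⊕ K)) :=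
  {B | ∃ k x y, (N k).Adj x y ∧ B = {Sum.inl x, Sum.inl y, Sum.inr k}}

/-- `C` is an extended `s`-configuration: up to renaming points, its blocks are exactly the
augmented edges of an extended `s`-pattern on a finite vertex set. (Since every point of `C` is in
a block, `φ` is onto the points that lie in some augmented edge.) -/
def TripleConfiguration.IsExtended {V : Type u} (C : TripleConfiguration V) (s : ℕ) : Prop :=
  ∃ (m : ℕ) (N : Option (Fin s) → SimpleGraph (Fin m)), IsExtendedPattern N ∧
    ∃ φ : V ↪ Fin m ⊕ Option (Fin s),
      (fun B : Finset V => B.map φ) '' C.blocks = augmentedBlocks N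

/-- `C` is `t`-Ramsey: in every `t`-colouring of the blocks of any sufficiently large finite
Steiner triple system there is a monochromatic copy of `C`. -/
def TripleConfiguration.IsRamsey {V : Type u} (C : TripleConfiguration V) (t : ℕ) : Prop :=
  ∃ n₀ : ℕ, ∀ (X : Type v) [Finite X] (S : SteinerTripleSystem X), n₀ ≤ Nat.card X →
    ∀ c : S.blocks → Fin t, ∃ (k : Fin t) (f : V ↪ X),
      ∀ B ∈ C.blocks, ∃ h : B.map f ∈ S.blocks, c ⟨B.map f, h⟩ = k

/-!
Write `op x y` for the third point of the block through `x` and `y`. An edge `xy` of colour class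
`i` of a pattern becomes a block `x`, `y`, `w i` for a point `w i` that has to be found, so that
`y = op x (w i)`. Because each edge of `M i` has an endpoint missed by all later classes, the
classes can be drawn in reverse order, each new edge being pendant or isolated. Hence every pattern
lies in a disjoint union of binomial trees, whose vertices are a root `x` and all points reached
from `x` by applying some of the links `w (s - 1), …, w 0` in this order
(`IsPattern.exists_coordinates`).

Such trees are found by averaging. Between two sets of positive density in a large system, some
point `w` and some colour serve a positive proportion of the pairs `x`, `op x w`
(`exists_dense_link`); this stays true when linearly many pairs are forbidden, which keeps the
vertices of a tree distinct and excludes rare colours. Iteration gives `s * t` links that serve a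
dense set of roots (`exists_treeSystem`), and `s` of these links have the same colour `κ`.

It remains to produce the additional edge, joining a vertex `p` of one tree to a vertex `q` of
another one by a block of colour `κ`. The possible images of `p`, and those of `q`, form sets of
positive density. If more than linearly many pairs between these two sets have colour `κ`, then one
such pair causes no coincidence among the points involved, and it extends greedily to a copy
of the configuration. Otherwise the construction is repeated between these two sets, with `κ` among
the rare colours from then on. All colours cannot become rare, so at most `t` rounds are needed
(`exists_monochromatic_realization`). In order that the links run between the two sets, the roots
come in two classes, and each link exchanges the two sides.
-/

open Finset Function

/-! ### Steiner triple systems as quasigroups -/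

/-- A binary operation with the identities of a Steiner quasigroup (idempotence is not needed),
together with a colouring `col` of the pairs which is constant on the pairs inside each triple
`{x, y, op x y}`. It encodes a Steiner triple system with coloured blocks: `op x y` is the third
point of the block through `x` and `y`, and `col x y` is the colour of that block. -/
structure ColoredSteinerQuasigroup (X : Type*) (K : Type*) where
  op : X → X → X
  col : X → X → K
  op_comm : ∀ x y, op x y = op y x
  op_op : ∀ x y, op x (op x y) = y
  col_comm : ∀ x y, col x y = col y x
  col_op : ∀ x y, col x (op x y) = col x y

namespace ColoredSteinerQuasigroup

variable {X K : Type*} (Q : ColoredSteinerQuasigroup X K)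

lemma op_op_right (x w : X) : Q.op (Q.op x w) w = x := by
  rw [Q.op_comm x w, Q.op_comm, Q.op_op]

lemma op_eq_iff {x y w : X} : Q.op x y = w ↔ y = Q.op x w :=
  ⟨fun h => by rw [← h, Q.op_op], fun h => by rw [h, Q.op_op]⟩

lemma op_left_injective (w : X) : Injective fun x => Q.op x w :=
  LeftInverse.injective (g := fun x => Q.op x w) fun x => Q.op_op_right x w

lemma col_op_right (x w : X) : Q.col (Q.op x w) w = Q.col x w := by
  rw [Q.op_comm, Q.col_comm, Q.col_op, Q.col_comm]

end ColoredSteinerQuasigroup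

namespace SteinerTripleSystem

variable {X : Type*} (S : SteinerTripleSystem X)

lemma exists_third [DecidableEq X] (x y : X) (h : x ≠ y) :
    ∃ z, ({x, y, z} : Finset X) ∈ S.blocks := by
  obtain ⟨B, hB, hx, hy⟩ := S.exists_block x y h
  have hsub : ({x, y} : Finset X) ⊆ B := by
    intro a ha
    simp only [mem_insert, mem_singleton] at ha
    rcases ha with rfl | rfl <;> assumption
  have h3 := S.card_eq_three B hB
  have h2 : #({x, y} : Finset X) = 2 := card_pair h
  have h1 : #(B \ {x, y}) = 1 := by rw [card_sdiff_of_subset hsub]; omega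
  obtain ⟨z, hz⟩ := card_eq_one.1 h1
  refine ⟨z, ?_⟩
  have : ({x, y, z} : Finset X) = B := by
    rw [← sdiff_union_of_subset hsub, hz]
    ext a
    simp only [mem_insert, mem_singleton, mem_union]
    tauto
  rwa [this]

/-- The coloured quasigroup of a Steiner triple system with coloured blocks. -/
lemma exists_coloredSteinerQuasigroup [DecidableEq X] {K : Type*} [Nonempty K]
    (c : S.blocks → K) :
    ∃ Q : ColoredSteinerQuasigroup X K, ∀ x y, x ≠ y →
      ∃ h : ({x, y, Q.op x y} : Finset X) ∈ S.blocks, c ⟨_, h⟩ = Q.col x y := by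
  classical
  choose third hthird using S.exists_third
  have ne : ∀ {x y z : X}, ({x, y, z} : Finset X) ∈ S.blocks → x ≠ y ∧ x ≠ z ∧ y ≠ z := by
    intro x y z h
    have h3 := S.card_eq_three _ h
    refine ⟨?_, ?_, ?_⟩ <;> rintro rfl
    · have := card_le_two (a := x) (b := z)
      simp only [insert_eq_of_mem, mem_insert, true_or] at h3
      omega
    · have := card_le_two (a := x) (b := y)
      have e : ({x, y, x} : Finset X) = {x, y} := by ext; simp; tauto
      rw [e] at h3
      omega
    · have := card_le_two (a := x) (b := y)
      have e : ({x, y, y} : Finset X) = {x, y} := by ext; simp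
      rw [e] at h3
      omega
  have uniq : ∀ {x y z z' : X}, ({x, y, z} : Finset X) ∈ S.blocks →
      ({x, y, z'} : Finset X) ∈ S.blocks → z = z' := by
    intro x y z z' h h'
    have e := S.linear _ h _ h' x y (ne h).1 (by simp) (by simp) (by simp) (by simp)
    have hz : z ∈ ({x, y, z'} : Finset X) := by rw [← e]; simp
    simp only [mem_insert, mem_singleton] at hz
    rcases hz with hz | hz | hz
    · exact absurd hz.symm (ne h).2.1
    · exact absurd hz.symm (ne h).2.2
    · exact hz
  let op : X → X → X := fun x y => if h : x = y then x else third x y h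
  have hop : ∀ x y, x ≠ y → ({x, y, op x y} : Finset X) ∈ S.blocks := by
    intro x y h
    simp only [op, dif_neg h]
    exact hthird x y h
  have hself : ∀ x, op x x = x := fun x => by simp [op]
  have swap12 : ∀ x y z : X, ({x, y, z} : Finset X) = {y, x, z} := fun x y z => by
    ext; simp; tauto
  have swap23 : ∀ x y z : X, ({x, y, z} : Finset X) = {x, z, y} := fun x y z => by
    ext; simp; tauto
  have comm : ∀ x y, op x y = op y x := by
    intro x y
    by_cases h : x = y
    · rw [h]
    · refine uniq (hop x y h) ?_
      rw [swap12]
      exact hop y x (Ne.symm h)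
  have opop : ∀ x y, op x (op x y) = y := by
    intro x y
    by_cases h : x = y
    · rw [h, hself, hself]
    · have hb := hop x y h
      refine uniq (hop x (op x y) (ne hb).2.1) ?_
      rw [swap23]
      exact hb
  let col : X → X → K := fun x y => if h : x = y then Classical.arbitrary K else c ⟨_, hop x y h⟩
  refine ⟨⟨op, col, comm, opop, ?_, ?_⟩, ?_⟩
  · intro x y
    by_cases h : x = y
    · rw [h]
    · simp only [col, dif_neg h, dif_neg (Ne.symm h)]
      congr 2
      rw [swap12, comm]
  · intro x y
    by_cases h : x = y
    · rw [h, hself]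
    · have h' := (ne (hop x y h)).2.1
      simp only [col, dif_neg h, dif_neg h']
      congr 2
      rw [swap23, opop]
  · intro x y h
    exact ⟨hop x y h, by simp only [col, dif_neg h]⟩

end SteinerTripleSystem

/-! ### Counting pairs -/

lemma card_le_of_forall_eq_right {X Y : Type*} [Fintype X] {P : Finset (X × X)} {f g : X → Y}
    (hg : Injective g) (h : ∀ p ∈ P, f p.1 = g p.2) : #P ≤ Fintype.card X := by
  refine card_le_card_of_injOn Prod.fst (fun _ _ => mem_univ _) ?_
  rintro ⟨a, b⟩ hp ⟨a', b'⟩ hp' (rfl : a = a')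
  rw [Prod.mk.injEq]
  exact ⟨rfl, hg ((h _ hp).symm.trans (h _ hp'))⟩

lemma card_le_of_forall_eq_left {X Y : Type*} [Fintype X] {P : Finset (X × X)} {f g : X → Y}
    (hf : Injective f) (h : ∀ p ∈ P, f p.1 = g p.2) : #P ≤ Fintype.card X := by
  refine card_le_card_of_injOn Prod.snd (fun _ _ => mem_univ _) ?_
  rintro ⟨a, b⟩ hp ⟨a', b'⟩ hp' (rfl : b = b')
  rw [Prod.mk.injEq]
  exact ⟨hf ((h _ hp).trans (h _ hp').symm), rfl⟩

lemma card_le_mul_of_forall_exists {α ι : Type*} {P : Finset α} {I : Finset ι}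
    {R : ι → α → Prop} {n : ℕ} (hP : ∀ a ∈ P, ∃ i ∈ I, R i a)
    (h : ∀ i ∈ I, ∀ G : Finset α, (∀ a ∈ G, R i a) → #G ≤ n) : #P ≤ #I * n := by
  classical
  refine (card_le_card ?_).trans (card_biUnion_le_card_mul I (fun i => {a ∈ P | R i a}) n
    fun i hi => h i hi _ fun a ha => (mem_filter.1 ha).2)
  intro a ha
  obtain ⟨i, hi, hia⟩ := hP a ha
  exact mem_biUnion.2 ⟨i, hi, mem_filter.2 ⟨ha, hia⟩⟩

/-- The averaging step: between two sets of positive density, even with linearly many pairs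
forbidden, some point `w` completes a positive proportion of the pairs `x, op x w` to blocks of one
colour. -/
lemma exists_dense_link (t : ℕ) {δ : ℝ} (hδ : 0 < δ) (C : ℕ) :
    ∃ δ' : ℝ, 0 < δ' ∧ ∃ n₀ : ℕ, ∀ (X : Type v) [Fintype X] [DecidableEq X]
      (Q : ColoredSteinerQuasigroup X (Fin t)), n₀ ≤ Fintype.card X → ∀ A B : Finset X,
      δ * Fintype.card X ≤ #A → δ * Fintype.card X ≤ #B →
      ∀ F : Finset (X × X), #F ≤ C * Fintype.card X →
      ∃ w k, δ' * Fintype.card X ≤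
        #{x ∈ A | Q.op x w ∈ B ∧ Q.col x w = k ∧ (x, Q.op x w) ∉ F} := by
  refine ⟨δ ^ 2 / (2 * (t + 1)), by positivity, ⌈2 * C / δ ^ 2⌉₊ + 1, ?_⟩
  intro X _ _ Q hn A B hA hB F hF
  set n := Fintype.card X with hn_def
  have hn1 : 0 < n := by omega
  have hnC : 2 * C / δ ^ 2 ≤ n := Nat.ceil_le.1 (by omega)
  obtain ⟨x₀⟩ : Nonempty X := Fintype.card_pos_iff.1 hn1
  have hnR : (0 : ℝ) < n := by exact_mod_cast hn1
  have hFR : (#F : ℝ) ≤ C * n := by exact_mod_cast hF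
  have hAB : (#(A ×ˢ B) : ℝ) ≤ #((A ×ˢ B) \ F) + #F := by
    exact_mod_cast (by
      have := le_card_sdiff F (A ×ˢ B)
      omega : #(A ×ˢ B) ≤ #((A ×ˢ B) \ F) + #F)
  have hmul : (δ * n) * (δ * n) ≤ #(A ×ˢ B) := by
    rw [card_product]
    push_cast
    gcongr
  have hCn : C * n ≤ δ ^ 2 * n * n / 2 := by
    rw [div_le_iff₀ (by positivity)] at hnC
    nlinarith
  have hcount : δ ^ 2 * n * n / 2 ≤ #((A ×ˢ B) \ F) := by nlinarith
  obtain ⟨⟨w, k⟩, -, hwk⟩ := exists_le_card_fiber_of_nsmul_le_card_of_maps_to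
    (s := (A ×ˢ B) \ F) (t := (univ : Finset (X × Fin t)))
    (f := fun p => (Q.op p.1 p.2, Q.col p.1 p.2)) (b := δ ^ 2 / (2 * (t + 1)) * n)
    (fun _ _ => mem_univ _) ⟨(x₀, Q.col x₀ x₀), mem_univ _⟩ (by
      refine le_trans ?_ hcount
      rw [card_univ, Fintype.card_prod, Fintype.card_fin, nsmul_eq_mul]
      push_cast
      rw [← hn_def]
      have : (t : ℝ) / (t + 1) ≤ 1 := by
        rw [div_le_one (by positivity)]
        linarith
      calc (n : ℝ) * t * (δ ^ 2 / (2 * (t + 1)) * n)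
          = δ ^ 2 * n * n / 2 * (t / (t + 1)) := by field_simp
        _ ≤ δ ^ 2 * n * n / 2 * 1 := by gcongr
        _ = _ := mul_one _)
  refine ⟨w, k, hwk.trans ?_⟩
  norm_cast
  refine card_le_card_of_injOn Prod.fst ?_ ?_
  · rintro ⟨x, y⟩ h
    simp only [coe_filter, mem_sdiff, mem_product, Set.mem_ofPred_eq, Prod.mk.injEq] at h ⊢
    obtain ⟨⟨⟨hx, hy⟩, hxy⟩, h1, rfl⟩ := h
    obtain rfl := Q.op_eq_iff.1 h1
    exact ⟨hx, hy, (Q.col_op x w).symm, hxy⟩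
  · rintro ⟨x, y⟩ h ⟨x', y'⟩ h' (rfl : x = x')
    simp only [coe_filter, mem_sdiff, mem_product, Set.mem_ofPred_eq, Prod.mk.injEq] at h h'
    rw [Prod.mk.injEq]
    exact ⟨rfl, (Q.op_eq_iff.1 h.2.1).trans (Q.op_eq_iff.1 h'.2.1).symm⟩

/-! ### Coordinates on a pattern -/

/-- Every pattern embeds colour by colour into a disjoint union of binomial trees: each vertex `v`
gets a root `r v` in its own component and a set `S v` of colours, these data determine `v`, and
along an edge of colour `i` the set changes by the insertion of `i` as a new minimum. -/
lemma IsPattern.exists_coordinates {W : Type*} [LinearOrder W] {s : ℕ} {M : Fin s → SimpleGraph W}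
    (hM : IsPattern M) :
    ∃ (r : W → W) (S : W → Finset (Fin s)),
      (∀ v v', r v = r v' → S v = S v' → v = v') ∧
      (∀ v, (⨆ i, M i).Reachable v (r v)) ∧
      ∀ i x y, (M i).Adj x y → r x = r y ∧
        (((∀ j ∈ S x, i < j) ∧ S y = insert i (S x)) ∨
          ((∀ j ∈ S y, i < j) ∧ S x = insert i (S y))) := by
  classical
  induction s with
  | zero => exact ⟨id, fun _ => ∅, fun v v' h _ => h, fun v => .refl v, fun i => i.elim0⟩
  | succ s ih =>
    have hle : (⨆ i : Fin s, M i.succ) ≤ ⨆ i, M i := iSup_le fun i => le_iSup M i.succ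
    have htail : IsPattern fun i : Fin s => M i.succ :=
      { matching := fun i => hM.matching i.succ
        edge_disjoint := fun i j hij =>
          hM.edge_disjoint i.succ j.succ fun h => hij (Fin.succ_injective _ h)
        acyclic := hM.acyclic.anti hle
        free_endpoint := fun i x y h => by
          obtain ⟨w, hw, hfree⟩ := hM.free_endpoint i.succ x y h
          exact ⟨w, hw, fun j hj => hfree j.succ (Fin.succ_lt_succ_iff.2 hj)⟩ }
    obtain ⟨r, S, hinj, hreach, hedge⟩ := ih htail
    let cov : W → Prop := fun v => ∃ (j : Fin s) (z : W), (M j.succ).Adj v z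
    -- `par v u`: the colour `0` edge `vu` is attached at `u` and has `v` as its new endpoint;
    -- the order on `W` decides when both endpoints are new
    let par : W → W → Prop := fun v u => (M 0).Adj v u ∧ ¬ cov v ∧ (cov u ∨ v < u)
    have hpar_unique : ∀ {v u u'}, par v u → par v u' → u = u' :=
      fun h h' => hM.matching 0 _ _ _ h.1 h'.1
    have hpar_not : ∀ {v u}, par v u → ∀ u', ¬ par u u' := by
      rintro v u ⟨h1, h2, h3⟩ u' ⟨h1', h2', h3'⟩
      obtain rfl : v = u' := hM.matching 0 _ _ _ h1.symm h1'
      rcases h3 with h3 | h3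
      · exact h2' h3
      · rcases h3' with h3' | h3'
        · exact h2 h3'
        · exact lt_asymm h3 h3'
    have hpar_edge : ∀ {x y}, (M 0).Adj x y → par x y ∨ par y x := by
      intro x y h
      have hxy : ¬ cov x ∨ ¬ cov y := by
        obtain ⟨w, hw, hfree⟩ := hM.free_endpoint 0 x y h
        have : ¬ cov w := fun ⟨j, z, hjz⟩ => hfree j.succ (Fin.succ_pos j) z hjz
        rcases hw with rfl | rfl
        · exact .inl this
        · exact .inr this
      have hlt := lt_or_gt_of_ne h.ne
      by_cases hx : cov x
      · exact .inr ⟨h.symm, hxy.resolve_left (not_not_intro hx), .inl hx⟩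
      by_cases hy : cov y
      · exact .inl ⟨h, hx, .inl hy⟩
      exact hlt.imp (fun hlt => ⟨h, hx, .inr hlt⟩) fun hlt => ⟨h.symm, hy, .inr hlt⟩
    let p : W → W := fun v => if h : ∃ u, par v u then h.choose else v
    have hp : ∀ {v u}, par v u → p v = u := by
      intro v u h
      have hex : ∃ u, par v u := ⟨u, h⟩
      simp only [p, dif_pos hex]
      exact hpar_unique hex.choose_spec h
    have hp' : ∀ {v}, ¬ (∃ u, par v u) → p v = v := fun h => by simp only [p, dif_neg h]
    let S' : W → Finset (Fin (s + 1)) := fun v =>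
      if ∃ u, par v u then insert 0 ((S (p v)).image Fin.succ) else (S (p v)).image Fin.succ
    have h0 : ∀ v, (0 : Fin (s + 1)) ∉ (S (p v)).image Fin.succ := by simp
    have hS0 : ∀ v, 0 ∈ S' v ↔ ∃ u, par v u := by
      intro v
      by_cases h : ∃ u, par v u
      · simp only [S', if_pos h, h, mem_insert_self]
      · simp only [S', if_neg h, h, h0]
    have hSerase : ∀ v, (S' v).erase 0 = (S (p v)).image Fin.succ := by
      intro v
      by_cases h : ∃ u, par v u
      · simp only [S', if_pos h, erase_insert (h0 v)]
      · simp only [S', if_neg h, erase_eq_of_notMem (h0 v)]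
    refine ⟨fun v => r (p v), S', ?_, ?_, ?_⟩
    · intro v v' hr hS
      have hpp : p v = p v' := by
        refine hinj _ _ hr ?_
        have := congrArg (fun A => A.erase 0) hS
        simp only [hSerase] at this
        exact image_injective (Fin.succ_injective s) this
      have hiff : (∃ u, par v u) ↔ ∃ u, par v' u := by rw [← hS0, ← hS0, hS]
      by_cases h : ∃ u, par v u
      · obtain ⟨u', hu'⟩ := hiff.1 h
        obtain ⟨u, hu⟩ := h
        rw [hp hu, hp hu'] at hpp
        subst hpp
        exact hM.matching 0 _ _ _ hu.1.symm hu'.1.symm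
      · rwa [hp' h, hp' (mt hiff.2 h)] at hpp
    · intro v
      have h1 : (⨆ i, M i).Reachable v (p v) := by
        by_cases h : ∃ u, par v u
        · obtain ⟨u, hu⟩ := h
          rw [hp hu]
          exact (SimpleGraph.Adj.reachable ((le_iSup M 0) hu.1))
        · rw [hp' h]
      exact h1.trans ((hreach (p v)).mono hle)
    · intro i x y hxy
      induction i using Fin.cases with
      | zero =>
        have key : ∀ {v u}, par v u → r (p v) = r (p u) ∧
            (∀ j ∈ S' u, 0 < j) ∧ S' v = insert 0 (S' u) := by
          intro v u h
          have hu : ¬ ∃ u', par u u' := fun ⟨u', h'⟩ => hpar_not h u' h'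
          have hv : ∃ u', par v u' := ⟨u, h⟩
          refine ⟨by rw [hp h, hp' hu], ?_, ?_⟩
          · intro j hj
            refine Fin.pos_of_ne_zero ?_
            rintro rfl
            exact hu ((hS0 u).1 hj)
          · simp only [S', if_pos hv, if_neg hu, hp h, hp' hu]
        rcases hpar_edge hxy with h | h
        · obtain ⟨h1, h2⟩ := key h
          exact ⟨h1, .inr h2⟩
        · obtain ⟨h1, h2⟩ := key h
          exact ⟨h1.symm, .inl h2⟩
      | succ i =>
        have hx : ¬ ∃ u, par x u := fun ⟨u, h⟩ => h.2.1 ⟨i, y, hxy⟩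
        have hy : ¬ ∃ u, par y u := fun ⟨u, h⟩ => h.2.1 ⟨i, x, hxy.symm⟩
        have hlt : ∀ {A : Finset (Fin s)}, (∀ j ∈ A, i < j) →
            ∀ j ∈ A.image Fin.succ, i.succ < j := by
          intro A hA j hj
          obtain ⟨j', hj', rfl⟩ := mem_image.1 hj
          exact Fin.succ_lt_succ_iff.2 (hA j' hj')
        simp only [S', if_neg hx, if_neg hy, hp' hx, hp' hy]
        obtain ⟨h1, h2⟩ := hedge i x y hxy
        refine ⟨h1, h2.imp ?_ ?_⟩
        · rintro ⟨h3, h4⟩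
          exact ⟨hlt h3, by rw [h4, image_insert]⟩
        · rintro ⟨h3, h4⟩
          exact ⟨hlt h3, by rw [h4, image_insert]⟩

/-! ### Systems of binomial trees -/

/-- A family of monochromatically linked binomial trees of order `T` in a coloured Steiner
quasigroup. There are two classes of roots, `roots false` and `roots true`. The tree with root `x`
has the vertices `vertex S x` for `S ⊆ {0, …, T - 1}`; when `i` lies below all elements of `S`, the
vertices of `S` and `insert i S` are joined by a block through `link i`, whose colour is `color i`.
All vertices of a tree lie in the given sets `A₀ false` and `A₀ true`, and the set containing
`vertex S x` depends only on `S` and on the class of the root `x`. -/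
structure TreeSystem {X K : Type*} (Q : ColoredSteinerQuasigroup X K) (T : ℕ)
    (A₀ : Bool → Finset X) where
  link : ℕ → X
  color : ℕ → K
  vertex : Finset ℕ → X → X
  side : Finset ℕ → Bool
  roots : Bool → Finset X
  roots_subset : ∀ b, roots b ⊆ A₀ b
  vertex_empty : ∀ x, vertex ∅ x = x
  vertex_injective : ∀ S, Injective (vertex S)
  vertex_mem : ∀ b, ∀ x ∈ roots b, ∀ S ⊆ range T, vertex S x ∈ A₀ (xor b (side S))
  eq_of_vertex_eq : ∀ b, ∀ x ∈ roots b, ∀ S ⊆ range T, ∀ S' ⊆ range T,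
    vertex S x = vertex S' x → S = S'
  vertex_insert : ∀ b, ∀ x ∈ roots b, ∀ S ⊆ range T, ∀ i < T, (∀ j ∈ S, i < j) →
    Q.op (vertex S x) (link i) = vertex (insert i S) x ∧ Q.col (vertex S x) (link i) = color i

namespace TreeSystem

variable {X K : Type*} {Q : ColoredSteinerQuasigroup X K}

/-- The trees consisting of single vertices. -/
noncomputable def single [Nonempty X] [Nonempty K] (A₀ : Bool → Finset X) : TreeSystem Q 0 A₀ where
  link _ := Classical.arbitrary X
  color _ := Classical.arbitrary K
  vertex _ x := x
  side _ := false
  roots := A₀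
  roots_subset _ := Subset.rfl
  vertex_empty _ := rfl
  vertex_injective _ := injective_id
  vertex_mem b x hx S _ := by simpa using hx
  eq_of_vertex_eq b x _ S hS S' hS' _ := by
    rw [range_zero, subset_empty] at hS hS'
    rw [hS, hS']
  vertex_insert b x _ S _ i hi := absurd hi (Nat.not_lt_zero i)

/-- Joining by a new link `w` each root `y` to a root `Q.op y w` of the other class, with disjoint
trees, gives binomial trees of the next order. -/
def extend {T : ℕ} {A₀ : Bool → Finset X} (R : TreeSystem Q T A₀) (w : X) (k : K)
    (roots' : Bool → Finset X)
    (hroots : ∀ b, roots' b ⊆ R.roots b)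
    (hop : ∀ b, ∀ y ∈ roots' b, Q.op y w ∈ R.roots (!b))
    (hcol : ∀ b, ∀ y ∈ roots' b, Q.col y w = k)
    (hne : ∀ b, ∀ y ∈ roots' b, ∀ S ⊆ range T, ∀ S' ⊆ range T,
      R.vertex S y ≠ R.vertex S' (Q.op y w)) : TreeSystem Q (T + 1) A₀ where
  link := update R.link T w
  color := update R.color T k
  vertex S x := R.vertex (S.erase T) (if T ∈ S then Q.op x w else x)
  side S := xor (decide (T ∈ S)) (R.side (S.erase T))
  roots := roots'
  roots_subset b := (hroots b).trans (R.roots_subset b)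
  vertex_empty x := by simp [R.vertex_empty]
  vertex_injective S := by
    refine (R.vertex_injective (S.erase T)).comp ?_
    by_cases h : T ∈ S
    · simp only [if_pos h]
      exact Q.op_left_injective w
    · simp only [if_neg h]
      exact injective_id
  vertex_mem b x hx S hS := by
    have hS' : S.erase T ⊆ range T := by
      rw [range_add_one] at hS
      exact subset_insert_iff.1 hS
    by_cases h : T ∈ S
    · have := R.vertex_mem _ _ (hop b x hx) _ hS'
      simpa [h] using this
    · have := R.vertex_mem _ _ (hroots b hx) _ hS'
      simpa [h] using this
  eq_of_vertex_eq b x hx S hS S' hS' h := by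
    rw [range_add_one] at hS hS'
    have hS := subset_insert_iff.1 hS
    have hS' := subset_insert_iff.1 hS'
    by_cases h1 : T ∈ S <;> by_cases h2 : T ∈ S' <;> simp only [h1, h2, if_true, if_false] at h
    · have := R.eq_of_vertex_eq _ _ (hop b x hx) _ hS _ hS' h
      rw [← insert_erase h1, this, insert_erase h2]
    · exact absurd h.symm (hne b x hx _ hS' _ hS)
    · exact absurd h (hne b x hx _ hS _ hS')
    · have := R.eq_of_vertex_eq _ _ (hroots b hx) _ hS _ hS' h
      rwa [erase_eq_of_notMem h1, erase_eq_of_notMem h2] at this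
  vertex_insert b x hx S hS i hi hiS := by
    rw [range_add_one] at hS
    have hS' := subset_insert_iff.1 hS
    rcases Nat.lt_succ_iff_lt_or_eq.1 hi with hiT | rfl
    · have hx' : (if T ∈ S then Q.op x w else x) ∈ R.roots (xor b (decide (T ∈ S))) := by
        by_cases h : T ∈ S
        · simpa [h] using hop b x hx
        · simpa [h] using hroots b hx
      have := R.vertex_insert _ _ hx' _ hS' i hiT fun j hj => hiS j (mem_of_mem_erase hj)
      simpa [hiT.ne, hiT.ne', erase_insert_of_ne] using this
    · obtain rfl : S = ∅ := by
        refine eq_empty_of_forall_notMem fun j hj => ?_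
        have h1 := hiS j hj
        have h2 := mem_insert.1 (hS hj)
        rw [mem_range] at h2
        omega
      simp [R.vertex_empty, hcol b x hx]

end TreeSystem

/-- Between dense sets there are dense systems of trees of any order, and their links can avoid
every colour that occurs on only linearly many pairs. -/
lemma exists_treeSystem (t : ℕ) {δ : ℝ} (hδ : 0 < δ) (C T : ℕ) :
    ∃ δ' : ℝ, 0 < δ' ∧ ∃ n₀ : ℕ, ∀ (X : Type v) [Fintype X] [DecidableEq X]
      (Q : ColoredSteinerQuasigroup X (Fin t)), n₀ ≤ Fintype.card X →
      ∀ A₀ : Bool → Finset X, (∀ b, δ * Fintype.card X ≤ #(A₀ b)) →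
      ∀ E : Finset (Fin t),
      #{p ∈ A₀ false ×ˢ A₀ true | Q.col p.1 p.2 ∈ E} ≤ C * Fintype.card X →
      ∃ R : TreeSystem Q T A₀, (∀ i < T, R.color i ∉ E) ∧
        ∀ b, δ' * Fintype.card X ≤ #(R.roots b) := by
  induction T with
  | zero =>
    refine ⟨δ, hδ, 1, fun X _ _ Q hn A₀ hA₀ E _ => ?_⟩
    have : Nonempty X := Fintype.card_pos_iff.1 (by omega)
    have : Nonempty (Fin t) := this.map fun x => Q.col x x
    exact ⟨.single A₀, fun i hi => absurd hi (Nat.not_lt_zero i), hA₀⟩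
  | succ T ih =>
    obtain ⟨δ₁, hδ₁, n₁, h₁⟩ := ih
    let I := (range T).powerset ×ˢ (range T).powerset
    obtain ⟨δ₂, hδ₂, n₂, h₂⟩ := exists_dense_link t hδ₁ (C + #I)
    refine ⟨δ₂, hδ₂, max (max n₁ n₂) 1, fun X _ _ Q hn A₀ hA₀ E hE => ?_⟩
    obtain ⟨R, hRE, hR⟩ := h₁ X Q (by omega) A₀ hA₀ E hE
    let F₁ : Finset (X × X) := {p ∈ A₀ false ×ˢ A₀ true | Q.col p.1 p.2 ∈ E}
    let F₂ : Finset (X × X) := {p ∈ univ | ∃ q ∈ I, R.vertex q.1 p.1 = R.vertex q.2 p.2}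
    have hF₂ : #F₂ ≤ #I * Fintype.card X :=
      card_le_mul_of_forall_exists (fun p hp => (mem_filter.1 hp).2)
        fun q _ G hG => card_le_of_forall_eq_right (R.vertex_injective q.2) hG
    have hF : #(F₁ ∪ F₂) ≤ (C + #I) * Fintype.card X := by
      rw [add_mul]
      exact (card_union_le _ _).trans (add_le_add hE hF₂)
    obtain ⟨w, k, hwk⟩ := h₂ X Q (by omega) _ _ (hR false) (hR true) _ hF
    set D : Finset X :=
      {x ∈ R.roots false | Q.op x w ∈ R.roots true ∧ Q.col x w = k ∧ (x, Q.op x w) ∉ F₁ ∪ F₂}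
      with hD
    have hmem : ∀ x ∈ D, x ∈ R.roots false ∧ Q.op x w ∈ R.roots true ∧ Q.col x w = k ∧
        k ∉ E ∧ ∀ S ⊆ range T, ∀ S' ⊆ range T, R.vertex S x ≠ R.vertex S' (Q.op x w) := by
      intro x hx
      simp only [hD, mem_filter, mem_union, not_or] at hx
      obtain ⟨h1, h2, h3, h4, h5⟩ := hx
      refine ⟨h1, h2, h3, fun hk => h4 ?_, fun S hS S' hS' h => h5 ?_⟩
      · simp only [F₁, mem_filter, mem_product]
        refine ⟨⟨R.roots_subset _ h1, R.roots_subset _ h2⟩, ?_⟩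
        rwa [Q.col_op, h3]
      · simp only [F₂, I, mem_filter, mem_univ, true_and, mem_product, mem_powerset]
        exact ⟨(S, S'), ⟨hS, hS'⟩, h⟩
    let roots' : Bool → Finset X := fun b => if b then D.image fun x => Q.op x w else D
    have himage : ∀ y ∈ roots' true, ∃ x ∈ D, Q.op x w = y ∧ Q.op y w = x := by
      intro y hy
      simp only [roots', if_true, mem_image] at hy
      obtain ⟨x, hx, rfl⟩ := hy
      exact ⟨x, hx, rfl, Q.op_op_right x w⟩
    refine ⟨R.extend w k roots' ?_ ?_ ?_ ?_, ?_, ?_⟩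
    · rintro (_ | _) y hy
      · exact (hmem y hy).1
      · obtain ⟨x, hx, rfl, -⟩ := himage y hy
        exact (hmem x hx).2.1
    · rintro (_ | _) y hy
      · exact (hmem y hy).2.1
      · obtain ⟨x, hx, -, h⟩ := himage y hy
        rw [h]
        exact (hmem x hx).1
    · rintro (_ | _) y hy
      · exact (hmem y hy).2.2.1
      · obtain ⟨x, hx, rfl, -⟩ := himage y hy
        rw [Q.col_op_right]
        exact (hmem x hx).2.2.1
    · rintro (_ | _) y hy S hS S' hS'
      · exact (hmem y hy).2.2.2.2 S hS S' hS'
      · obtain ⟨x, hx, rfl, h⟩ := himage y hy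
        rw [h]
        exact ((hmem x hx).2.2.2.2 S' hS' S hS).symm
    · intro i hi
      rcases Nat.lt_succ_iff_lt_or_eq.1 hi with hiT | rfl
      · simpa [TreeSystem.extend, hiT.ne] using hRE i hiT
      · have hpos : 0 < #D := by
          have : (0 : ℝ) < δ₂ * Fintype.card X :=
            mul_pos hδ₂ (by exact_mod_cast (by omega : 0 < Fintype.card X))
          exact_mod_cast this.trans_le hwk
        obtain ⟨x, hx⟩ := card_pos.1 hpos
        simpa [TreeSystem.extend] using (hmem x hx).2.2.2.1
    · rintro (_ | _)
      · exact hwk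
      · change _ ≤ (#(D.image fun x => Q.op x w) : ℝ)
        rwa [card_image_of_injective _ (Q.op_left_injective w)]

/-! ### Embedding a pattern into a system of trees -/

/-- Greedy choice of finitely many points of `A` that pairwise avoid a symmetric relation of
bounded degree. -/
lemma exists_forall_notMem_of_card_lt {X W : Type*} [Fintype W] {A G : Finset X}
    {conf : X → Finset X} {K : ℕ} (hK : ∀ x, #(conf x) ≤ K)
    (hsymm : ∀ x y, y ∈ conf x → x ∈ conf y) (h : #G + Fintype.card W * K < #A) :
    ∃ ρ : W → X, (∀ v, ρ v ∈ A ∧ ρ v ∉ G) ∧ ∀ v v', v ≠ v' → ρ v' ∉ conf (ρ v) := by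
  classical
  suffices H : ∀ U : Finset W, ∃ ρ : W → X, (∀ v ∈ U, ρ v ∈ A ∧ ρ v ∉ G) ∧
      ∀ v ∈ U, ∀ v' ∈ U, v ≠ v' → ρ v' ∉ conf (ρ v) by
    obtain ⟨ρ, h1, h2⟩ := H univ
    exact ⟨ρ, fun v => h1 v (mem_univ v), fun v v' => h2 v (mem_univ v) v' (mem_univ v')⟩
  intro U
  induction U using Finset.induction_on with
  | empty =>
    obtain ⟨a, -⟩ := card_pos.1 (by omega : 0 < #A)
    exact ⟨fun _ => a, by simp, by simp⟩
  | insert u U hu ih =>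
    obtain ⟨ρ, h1, h2⟩ := ih
    have hcard : #(G ∪ U.biUnion fun v => conf (ρ v)) < #A := by
      have h3 : #(U.biUnion fun v => conf (ρ v)) ≤ #U * K :=
        card_biUnion_le_card_mul _ _ _ fun v _ => hK _
      have h4 : #U * K ≤ Fintype.card W * K := Nat.mul_le_mul_right _ (card_le_univ U)
      have h5 := card_union_le G (U.biUnion fun v => conf (ρ v))
      omega
    obtain ⟨x, hxA, hx⟩ := exists_mem_notMem_of_card_lt_card hcard
    simp only [mem_union, mem_biUnion, not_or, not_exists, not_and] at hx
    have hupd : ∀ v ∈ U, update ρ u x v = ρ v := fun v hv =>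
      update_of_ne (by rintro rfl; exact hu hv) _ _
    refine ⟨update ρ u x, ?_, ?_⟩
    · intro v hv
      rcases mem_insert.1 hv with rfl | hv
      · rw [update_self]
        exact ⟨hxA, hx.1⟩
      · rw [hupd v hv]
        exact h1 v hv
    · intro v hv v' hv' hne
      rcases mem_insert.1 hv with rfl | hvU <;> rcases mem_insert.1 hv' with rfl | hvU'
      · exact absurd rfl hne
      · rw [update_self, hupd v' hvU']
        exact fun hc => hx.2 v' hvU' (hsymm _ _ hc)
      · rw [update_self, hupd v hvU]
        exact hx.2 v hvU
      · rw [hupd v hvU, hupd v' hvU']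
        exact h2 v hvU v' hvU' hne

namespace TreeSystem

variable {X K : Type*} {Q : ColoredSteinerQuasigroup X K} {T : ℕ} {A₀ : Bool → Finset X}

lemma link_injOn (R : TreeSystem Q T A₀) {b : Bool} {x : X} (hx : x ∈ R.roots b) {i j : ℕ}
    (hi : i < T) (hj : j < T) (h : R.link i = R.link j) : i = j := by
  have key : ∀ i < T, Q.op x (R.link i) = R.vertex {i} x := by
    intro i hi
    have := (R.vertex_insert b x hx ∅ (empty_subset _) i hi (by simp)).1
    rwa [R.vertex_empty] at this
  have hij : R.vertex {i} x = R.vertex {j} x := by rw [← key i hi, ← key j hj, h]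
  exact singleton_injective
    (R.eq_of_vertex_eq b x hx _ (by simpa using hi) _ (by simpa using hj) hij)

/-- The trees rooted at `a` and `b` are disjoint, and the block joining the vertex `P` of the first
tree to the vertex `P'` of the second one has a third point, which is new; all these points also
differ from the links. -/
structure IsFreePair (R : TreeSystem Q T A₀) (P P' : Finset ℕ) (a b : X) : Prop where
  vertex_ne : ∀ S ⊆ range T, ∀ S' ⊆ range T, R.vertex S a ≠ R.vertex S' b
  left_ne_link : ∀ S ⊆ range T, ∀ i < T, R.vertex S a ≠ R.link i
  right_ne_link : ∀ S ⊆ range T, ∀ i < T, R.vertex S b ≠ R.link i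
  op_ne_link : ∀ i < T, Q.op (R.vertex P a) (R.vertex P' b) ≠ R.link i
  op_ne_left : ∀ S ⊆ range T, Q.op (R.vertex P a) (R.vertex P' b) ≠ R.vertex S a
  op_ne_right : ∀ S ⊆ range T, Q.op (R.vertex P a) (R.vertex P' b) ≠ R.vertex S b

/-- Only linearly many pairs are not free: each failing condition makes one root determine the
other. -/
lemma card_le_of_forall_not_isFreePair [Fintype X] (R : TreeSystem Q T A₀) (P P' : Finset ℕ)
    (B : Finset (X × X)) (hB : ∀ p ∈ B, ¬ R.IsFreePair P P' p.1 p.2) :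
    #B ≤ (2 ^ T * 2 ^ T + 2 ^ T * T + 2 ^ T * T + T + 2 ^ T + 2 ^ T) * Fintype.card X := by
  classical
  let I := (range T).powerset
  have hI : #I = 2 ^ T := by simp [I]
  let J := range T
  have hJ : #J = T := by simp [J]
  let B₁ := {p ∈ B | ∃ q ∈ I ×ˢ I, R.vertex q.1 p.1 = R.vertex q.2 p.2}
  let B₂ := {p ∈ B | ∃ q ∈ I ×ˢ J, R.vertex q.1 p.1 = R.link q.2}
  let B₃ := {p ∈ B | ∃ q ∈ I ×ˢ J, R.vertex q.1 p.2 = R.link q.2}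
  let B₄ := {p ∈ B | ∃ i ∈ J, Q.op (R.vertex P p.1) (R.vertex P' p.2) = R.link i}
  let B₅ := {p ∈ B | ∃ S ∈ I, Q.op (R.vertex P p.1) (R.vertex P' p.2) = R.vertex S p.1}
  let B₆ := {p ∈ B | ∃ S ∈ I, Q.op (R.vertex P p.1) (R.vertex P' p.2) = R.vertex S p.2}
  have h₁ : #B₁ ≤ (2 ^ T * 2 ^ T) * Fintype.card X := by
    rw [← hI, ← card_product]
    exact card_le_mul_of_forall_exists (fun p hp => (mem_filter.1 hp).2)
      fun q _ G hG => card_le_of_forall_eq_right (R.vertex_injective q.2) hG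
  have h₂ : #B₂ ≤ (2 ^ T * T) * Fintype.card X := by
    rw [← hI, ← hJ, ← card_product]
    exact card_le_mul_of_forall_exists (fun p hp => (mem_filter.1 hp).2)
      fun q _ G hG => card_le_of_forall_eq_left (g := fun _ => R.link q.2)
        (R.vertex_injective q.1) hG
  have h₃ : #B₃ ≤ (2 ^ T * T) * Fintype.card X := by
    rw [← hI, ← hJ, ← card_product]
    exact card_le_mul_of_forall_exists (fun p hp => (mem_filter.1 hp).2)
      fun q _ G hG => card_le_of_forall_eq_right (f := fun _ => R.link q.2)
        (R.vertex_injective q.1) fun p hp => (hG p hp).symm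
  have h₄ : #B₄ ≤ T * Fintype.card X := by
    conv_rhs => rw [← hJ]
    exact card_le_mul_of_forall_exists (fun p hp => (mem_filter.1 hp).2)
      fun i _ G hG => card_le_of_forall_eq_right
        (f := fun a => Q.op (R.vertex P a) (R.link i)) (R.vertex_injective P')
        fun p hp => (Q.op_eq_iff.1 (hG p hp)).symm
  have h₅ : #B₅ ≤ 2 ^ T * Fintype.card X := by
    rw [← hI]
    exact card_le_mul_of_forall_exists (fun p hp => (mem_filter.1 hp).2)
      fun S _ G hG => card_le_of_forall_eq_right
        (f := fun a => Q.op (R.vertex P a) (R.vertex S a)) (R.vertex_injective P')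
        fun p hp => (Q.op_eq_iff.1 (hG p hp)).symm
  have h₆ : #B₆ ≤ 2 ^ T * Fintype.card X := by
    rw [← hI]
    exact card_le_mul_of_forall_exists (fun p hp => (mem_filter.1 hp).2)
      fun S _ G hG => card_le_of_forall_eq_left
        (g := fun b => Q.op (R.vertex P' b) (R.vertex S b)) (R.vertex_injective P)
        fun p hp => Q.op_eq_iff.1 ((Q.op_comm _ _).trans (hG p hp))
  have hsub : B ⊆ B₁ ∪ B₂ ∪ B₃ ∪ B₄ ∪ B₅ ∪ B₆ := by
    intro p hp
    by_contra hc
    simp only [B₁, B₂, B₃, B₄, B₅, B₆, I, J, mem_union, mem_filter, hp, true_and, mem_product,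
      mem_powerset, Prod.exists, not_or, not_exists, not_and, and_imp, mem_range] at hc
    obtain ⟨⟨⟨⟨⟨c1, c2⟩, c3⟩, c4⟩, c5⟩, c6⟩ := hc
    exact hB p hp ⟨fun S hS S' hS' => c1 S S' hS hS', fun S hS i hi => c2 S i hS hi,
      fun S hS i hi => c3 S i hS hi, c4, c5, c6⟩
  have := card_le_card hsub
  have u1 := card_union_le (B₁ ∪ B₂ ∪ B₃ ∪ B₄ ∪ B₅) B₆
  have u2 := card_union_le (B₁ ∪ B₂ ∪ B₃ ∪ B₄) B₅
  have u3 := card_union_le (B₁ ∪ B₂ ∪ B₃) B₄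
  have u4 := card_union_le (B₁ ∪ B₂) B₃
  have u5 := card_union_le B₁ B₂
  simp only [add_mul] at h₁ h₂ h₃ h₄ h₅ h₆ ⊢
  omega

/-- A free pair `a`, `b` of roots extends to a choice of roots, one for each element of `W`, whose
trees are disjoint from each other, from the links and from the point `z`. -/
lemma exists_roots [Fintype X] (R : TreeSystem Q T A₀) {W : Type*} [Fintype W] {u u' : W}
    (hu : u ≠ u') {P P' : Finset ℕ} {b b' : Bool} {x x' : X} (hx : x ∈ R.roots b)
    (hx' : x' ∈ R.roots b') (hfree : R.IsFreePair P P' x x')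
    (hcard : 2 * (2 ^ T * 2 ^ T) + 2 ^ T * (T + 1) + Fintype.card W * (2 ^ T * 2 ^ T) <
      #(R.roots false)) :
    ∃ ρ : W → X, ρ u = x ∧ ρ u' = x' ∧ (∀ v, ∃ β, ρ v ∈ R.roots β) ∧
      (∀ v v', v ≠ v' → ∀ S ⊆ range T, ∀ S' ⊆ range T, R.vertex S (ρ v) ≠ R.vertex S' (ρ v')) ∧
      (∀ v, ∀ S ⊆ range T, ∀ i < T, R.vertex S (ρ v) ≠ R.link i) ∧
      ∀ v, ∀ S ⊆ range T, R.vertex S (ρ v) ≠ Q.op (R.vertex P x) (R.vertex P' x') := by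
  classical
  let z := Q.op (R.vertex P x) (R.vertex P' x')
  let I := (range T).powerset
  have hI : #I = 2 ^ T := by simp [I]
  have hI' : ∀ {S}, S ∈ I ↔ S ⊆ range T := mem_powerset
  let Z := insert z ((range T).image R.link)
  have hZ : #Z ≤ T + 1 := (card_insert_le _ _).trans
    (Nat.succ_le_succ (card_image_le.trans (card_range T).le))
  let conf : X → Finset X := fun y =>
    {y' ∈ univ | ∃ q ∈ I ×ˢ I, R.vertex q.1 y = R.vertex q.2 y'}
  have hconf : ∀ {y y'}, y' ∈ conf y ↔
      ∃ S ∈ I, ∃ S' ∈ I, R.vertex S y = R.vertex S' y' := by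
    intro y y'
    simp only [conf, mem_filter, mem_univ, true_and, mem_product, Prod.exists]
    constructor
    · rintro ⟨S, S', ⟨h1, h2⟩, h3⟩
      exact ⟨S, h1, S', h2, h3⟩
    · rintro ⟨S, h1, S', h2, h3⟩
      exact ⟨S, S', ⟨h1, h2⟩, h3⟩
  have hsymm : ∀ y y', y' ∈ conf y → y ∈ conf y' := by
    intro y y' h
    obtain ⟨S, hS, S', hS', h⟩ := hconf.1 h
    exact hconf.2 ⟨S', hS', S, hS, h.symm⟩
  have hK : ∀ y, #(conf y) ≤ 2 ^ T * 2 ^ T := by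
    intro y
    have : #(conf y) ≤ #(I ×ˢ I) * 1 :=
      card_le_mul_of_forall_exists (fun p hp => (mem_filter.1 hp).2) fun q _ G hG =>
        card_le_one.2 fun c hc d hd => R.vertex_injective q.2 ((hG c hc).symm.trans (hG d hd))
    rwa [mul_one, card_product, hI] at this
  let G₀ : Finset X := {y ∈ univ | ∃ q ∈ I ×ˢ Z, R.vertex q.1 y = q.2}
  have hG₀ : #G₀ ≤ 2 ^ T * (T + 1) := by
    have : #G₀ ≤ #(I ×ˢ Z) * 1 :=
      card_le_mul_of_forall_exists (fun p hp => (mem_filter.1 hp).2) fun q _ G hG =>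
        card_le_one.2 fun c hc d hd => R.vertex_injective q.1 ((hG c hc).trans (hG d hd).symm)
    rw [mul_one, card_product, hI] at this
    exact this.trans (Nat.mul_le_mul_left _ hZ)
  have hG : #(conf x ∪ conf x' ∪ G₀) + Fintype.card W * (2 ^ T * 2 ^ T) < #(R.roots false) := by
    have h1 := card_union_le (conf x ∪ conf x') G₀
    have h2 := card_union_le (conf x) (conf x')
    have h3 := hK x
    have h4 := hK x'
    omega
  obtain ⟨ρ, hρ, hρρ⟩ := exists_forall_notMem_of_card_lt (W := W) hK hsymm hG
  have hρA := fun v => (hρ v).1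
  have hρx : ∀ v, ρ v ∉ conf x := fun v h => (hρ v).2 (by simp [h])
  have hρx' : ∀ v, ρ v ∉ conf x' := fun v h => (hρ v).2 (by simp [h])
  have hρG : ∀ v, ∀ S ⊆ range T, ∀ c ∈ Z, R.vertex S (ρ v) ≠ c := by
    intro v S hS c hc h
    refine (hρ v).2 (mem_union_right _ ?_)
    simp only [G₀, mem_filter, mem_univ, true_and, mem_product]
    exact ⟨(S, c), ⟨hI'.2 hS, hc⟩, h⟩
  have hlinkZ : ∀ i < T, R.link i ∈ Z := fun i hi =>
    mem_insert_of_mem (mem_image_of_mem _ (mem_range.2 hi))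
  have hxx' : x' ∉ conf x := by
    intro h
    obtain ⟨S, hS, S', hS', h⟩ := hconf.1 h
    exact hfree.vertex_ne S (hI'.1 hS) S' (hI'.1 hS') h
  -- the greedy choice, corrected at the two prescribed places
  let ρ' : W → X := fun v => if v = u then x else if v = u' then x' else ρ v
  have hρ' : ∀ v, (v = u ∧ ρ' v = x) ∨ (v = u' ∧ ρ' v = x') ∨ (ρ' v = ρ v) := by
    intro v
    by_cases h1 : v = u
    · exact .inl ⟨h1, by simp [ρ', h1]⟩
    · by_cases h2 : v = u'
      · exact .inr (.inl ⟨h2, by simp [ρ', h2, hu.symm]⟩)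
      · exact .inr (.inr (by simp [ρ', h1, h2]))
  have hne : ∀ v v', v ≠ v' → ρ' v' ∉ conf (ρ' v) := by
    intro v v' hvv'
    rcases hρ' v with ⟨rfl, h1⟩ | ⟨rfl, h1⟩ | h1 <;>
      rcases hρ' v' with ⟨rfl, h2⟩ | ⟨rfl, h2⟩ | h2 <;>
      first | exact absurd rfl hvv' | rw [h1, h2]
    · exact hxx'
    · exact hρx v'
    · exact mt (hsymm _ _) hxx'
    · exact hρx' v'
    · exact mt (hsymm _ _) (hρx v)
    · exact mt (hsymm _ _) (hρx' v)
    · exact hρρ v v' hvv'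
  refine ⟨ρ', by simp [ρ'], by simp [ρ', hu.symm], ?_, ?_, ?_, ?_⟩
  · intro v
    rcases hρ' v with ⟨-, h⟩ | ⟨-, h⟩ | h <;> rw [h]
    exacts [⟨b, hx⟩, ⟨b', hx'⟩, ⟨false, hρA v⟩]
  · intro v v' hvv' S hS S' hS' h
    exact hne v v' hvv' (hconf.2 ⟨S, hI'.2 hS, S', hI'.2 hS', h⟩)
  · intro v S hS i hi
    rcases hρ' v with ⟨-, h⟩ | ⟨-, h⟩ | h <;> rw [h]
    exacts [hfree.left_ne_link S hS i hi, hfree.right_ne_link S hS i hi,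
      hρG v S hS _ (hlinkZ i hi)]
  · intro v S hS
    rcases hρ' v with ⟨-, h⟩ | ⟨-, h⟩ | h <;> rw [h]
    exacts [(hfree.op_ne_left S hS).symm, (hfree.op_ne_right S hS).symm,
      hρG v S hS _ (mem_insert_self _ _)]

end TreeSystem

/-- The combinatorial core: coordinates as in `IsPattern.exists_coordinates`, with an additional
edge between elements `p` and `q` of different trees, are realised in one colour in every large
system. The induction is on the number of colours outside `E`, the set of colours known to be rare
between `A₀ false` and `A₀ true`. If the common colour `κ` of some links occurs on more than
linearly many pairs consisting of a possible image of `p` and a possible image of `q`, one of these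
pairs extends to an embedding; otherwise the argument is repeated between the sets of these images
with `κ` added to `E`. -/
lemma exists_monochromatic_realization {W : Type*} [Fintype W] {s t : ℕ} (hs : 1 ≤ s) (ht : 1 ≤ t)
    {r : W → W} {S : W → Finset (Fin s)} (hinj : ∀ v v', r v = r v' → S v = S v' → v = v')
    {p q : W} (hpq : r p ≠ r q) (m : ℕ) :
    ∀ {δ : ℝ}, 0 < δ → ∀ C : ℕ, ∃ n₀ : ℕ, ∀ (X : Type v) [Fintype X] [DecidableEq X]
      (Q : ColoredSteinerQuasigroup X (Fin t)), n₀ ≤ Fintype.card X →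
      ∀ A₀ : Bool → Finset X, (∀ b, δ * Fintype.card X ≤ #(A₀ b)) →
      ∀ E : Finset (Fin t), #Eᶜ < m →
      #{p ∈ A₀ false ×ˢ A₀ true | Q.col p.1 p.2 ∈ E} ≤ C * Fintype.card X →
      ∃ (κ : Fin t) (f : W → X) (z : Option (Fin s) → X), Injective (Sum.elim f z) ∧
        (∀ i x y, r x = r y → (∀ j ∈ S x, i < j) → S y = insert i (S x) →
          Q.op (f x) (f y) = z (some i) ∧ Q.col (f x) (f y) = κ) ∧
        Q.op (f p) (f q) = z none ∧ Q.col (f p) (f q) = κ := by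
  induction m with
  | zero => exact fun _ _ => ⟨0, fun X _ _ Q _ A₀ _ E h => absurd h (Nat.not_lt_zero _)⟩
  | succ m ih =>
    intro δ hδ C
    let T := s * t
    obtain ⟨δ₁, hδ₁, n₁, h₁⟩ := exists_treeSystem t hδ C T
    let L := 2 ^ T * 2 ^ T + 2 ^ T * T + 2 ^ T * T + T + 2 ^ T + 2 ^ T
    obtain ⟨n₂, h₂⟩ := ih hδ₁ (C + L)
    let R₀ := 2 * (2 ^ T * 2 ^ T) + 2 ^ T * (T + 1) + Fintype.card W * (2 ^ T * 2 ^ T)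
    refine ⟨max (max n₁ n₂) (⌊R₀ / δ₁⌋₊ + 1), fun X _ _ Q hn A₀ hA₀ E hEm hE => ?_⟩
    obtain ⟨R, hRE, hR⟩ := h₁ X Q (by omega) A₀ hA₀ E hE
    have hR₀ : R₀ < #(R.roots false) := by
      have h3 : R₀ / δ₁ < Fintype.card X := (Nat.floor_lt (by positivity)).1 (by omega)
      rw [div_lt_iff₀ hδ₁, mul_comm] at h3
      exact_mod_cast h3.trans_le (hR false)
    -- `s` of the `s * t` links have the same colour
    obtain ⟨κ, -, hκ⟩ := exists_le_card_fiber_of_mul_le_card_of_maps_to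
      (s := range T) (t := (univ : Finset (Fin t))) (f := R.color) (n := s)
      (fun _ _ => mem_univ _) ⟨⟨0, ht⟩, mem_univ _⟩
      (by rw [card_univ, Fintype.card_fin, card_range, mul_comm])
    let g := orderEmbOfCardLe _ hκ
    have hg : ∀ i, g i < T ∧ R.color (g i) = κ := fun i => by
      have := orderEmbOfCardLe_mem _ hκ i
      rwa [mem_filter, mem_range] at this
    have hκE : κ ∉ E := by
      have := hg ⟨0, hs⟩
      rw [← this.2]
      exact hRE _ this.1
    let P : W → Finset ℕ := fun v => (S v).map g.toEmbedding
    have hP : ∀ v, P v ⊆ range T := by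
      intro v j hj
      obtain ⟨i, -, rfl⟩ := mem_map.1 hj
      exact mem_range.2 (hg i).1
    -- these classes of roots put the images of `p` and `q` into `A₀ false` and `A₀ true`
    let b := R.side (P p)
    let b' := !R.side (P q)
    have hmemp : ∀ x ∈ R.roots b, R.vertex (P p) x ∈ A₀ false := fun x hx => by
      simpa [b] using R.vertex_mem b x hx (P p) (hP p)
    have hmemq : ∀ x ∈ R.roots b', R.vertex (P q) x ∈ A₀ true := fun x hx => by
      simpa [b'] using R.vertex_mem b' x hx (P q) (hP q)
    by_cases hgood : ∃ x ∈ R.roots b, ∃ x' ∈ R.roots b', R.IsFreePair (P p) (P q) x x' ∧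
        Q.col (R.vertex (P p) x) (R.vertex (P q) x') = κ
    · obtain ⟨x, hx, x', hx', hfree, hcol⟩ := hgood
      obtain ⟨ρ, hρp, hρq, hρ, hdisj, hlink, hz⟩ := R.exists_roots hpq hx hx' hfree hR₀
      refine ⟨κ, fun v => R.vertex (P v) (ρ (r v)), fun o => o.elim
        (Q.op (R.vertex (P p) x) (R.vertex (P q) x')) (fun i => R.link (g i)), ?_, ?_, ?_, ?_⟩
      · refine Injective.sumElim ?_ ?_ ?_
        · intro v v' hvv'
          have hr : r v = r v' := by
            by_contra hne
            exact hdisj _ _ hne _ (hP v) _ (hP v') hvv'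
          simp only [hr] at hvv'
          obtain ⟨β, hβ⟩ := hρ (r v')
          have hPP := R.eq_of_vertex_eq β _ hβ _ (hP v) _ (hP v') hvv'
          exact hinj v v' hr (map_injective _ hPP)
        · rintro (_ | i) (_ | j) hij
          · rfl
          · exact absurd hij (hfree.op_ne_link _ (hg j).1)
          · exact absurd hij.symm (hfree.op_ne_link _ (hg i).1)
          · rw [g.injective (R.link_injOn hx (hg i).1 (hg j).1 hij)]
        · rintro v (_ | i)
          · exact hz _ _ (hP v)
          · exact hlink _ _ (hP v) _ (hg i).1
      · intro i y y' hr hmin hins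
        obtain ⟨β, hβ⟩ := hρ (r y')
        have hP' : P y' = insert (g i) (P y) := by
          simp only [P, hins, map_insert]
          rfl
        obtain ⟨h3, h4⟩ := R.vertex_insert β _ hβ _ (hP y) (g i) (hg i).1 (by
          intro j hj
          obtain ⟨j', hj', rfl⟩ := mem_map.1 hj
          exact g.strictMono (hmin j' hj'))
        simp only [hr, hP', ← h3, Q.op_op, Q.col_op, h4, (hg i).2, and_self, Option.elim]
      · simp only [hρp, hρq, Option.elim]
      · simpa only [hρp, hρq] using hcol
    · push Not at hgood
      let A₁ : Bool → Finset X := fun c =>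
        if c then (R.roots b').image (R.vertex (P q)) else (R.roots b).image (R.vertex (P p))
      refine h₂ X Q (by omega) A₁ ?_ (insert κ E) ?_ ?_
      · rintro (_ | _)
        · change _ ≤ (#((R.roots b).image (R.vertex (P p))) : ℝ)
          rw [card_image_of_injective _ (R.vertex_injective _)]
          exact hR b
        · change _ ≤ (#((R.roots b').image (R.vertex (P q))) : ℝ)
          rw [card_image_of_injective _ (R.vertex_injective _)]
          exact hR b'
      · have : #(insert κ E)ᶜ < #Eᶜ := by
          refine card_lt_card (compl_ssubset_compl.2 (ssubset_insert hκE))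
        omega
      · let B : Finset (X × X) := {y ∈ R.roots b ×ˢ R.roots b' |
          Q.col (R.vertex (P p) y.1) (R.vertex (P q) y.2) = κ}
        have hB : #B ≤ L * Fintype.card X := by
          refine R.card_le_of_forall_not_isFreePair (P p) (P q) B fun y hy hfree => ?_
          simp only [B, mem_filter, mem_product] at hy
          exact hgood _ hy.1.1 _ hy.1.2 hfree hy.2
        rw [add_mul]
        refine (card_le_card ?_).trans ((card_union_le _ _).trans (add_le_add hE
          (card_image_le.trans hB :
            #(B.image (Prod.map (R.vertex (P p)) (R.vertex (P q)))) ≤ _)))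
        rintro ⟨y, y'⟩ hy
        simp only [A₁, mem_filter, mem_product, if_true, Bool.false_eq_true, if_false,
          mem_insert, mem_image] at hy
        obtain ⟨⟨⟨x, hx, rfl⟩, ⟨x', hx', rfl⟩⟩, hcol⟩ := hy
        rcases hcol with hcol | hcol
        · refine mem_union_right _ (mem_image.2 ⟨(x, x'), ?_, rfl⟩)
          simp only [B, mem_filter, mem_product]
          exact ⟨⟨hx, hx'⟩, hcol⟩
        · refine mem_union_left _ ?_
          simp only [mem_filter, mem_product]
          exact ⟨⟨hmemp x hx, hmemq x' hx'⟩, hcol⟩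

theorem mainTheorem3 {V : Type u} (C : TripleConfiguration V) (s t : ℕ) (hs : 1 ≤ s) (ht : 1 ≤ t)
    (hC : C.IsExtended s) : TripleConfiguration.IsRamsey.{u, v} C t := by
  classical
  obtain ⟨m, N, ⟨hN, p, q, hpq, hnone⟩, φ, hφ⟩ := hC
  obtain ⟨r, S, hinj, hreach, hedge⟩ := hN.exists_coordinates
  have hrpq : r p ≠ r q := fun h => hpq ((hreach p).trans (h ▸ (hreach q).symm))
  obtain ⟨n₀, hn₀⟩ := exists_monochromatic_realization.{v} hs ht hinj hrpq (t + 1) one_pos 0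
  refine ⟨n₀, fun X _ 𝒮 hX c => ?_⟩
  have := Fintype.ofFinite X
  have : Nonempty (Fin t) := ⟨⟨0, ht⟩⟩
  obtain ⟨Q, hQ⟩ := 𝒮.exists_coloredSteinerQuasigroup c
  obtain ⟨κ, f, z, hfz, hop, hop', hcol'⟩ := hn₀ X Q (by rwa [← Nat.card_eq_fintype_card])
    (fun _ => univ) (fun _ => by rw [one_mul, card_univ]) ∅
    (by rw [compl_empty, card_univ, Fintype.card_fin]; omega) (by simp)
  have hadj : ∀ k x y, (N k).Adj x y → Q.op (f x) (f y) = z k ∧ Q.col (f x) (f y) = κ := by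
    rintro (_ | i) x y hxy
    · rw [hnone, SimpleGraph.edge_adj] at hxy
      rcases hxy.1 with ⟨rfl, rfl⟩ | ⟨rfl, rfl⟩
      · exact ⟨hop', hcol'⟩
      · exact ⟨(Q.op_comm _ _).trans hop', (Q.col_comm _ _).trans hcol'⟩
    · obtain ⟨h1, ⟨h2, h3⟩ | ⟨h2, h3⟩⟩ := hedge i x y hxy
      · exact hop i x y h1 h2 h3
      · rw [Q.op_comm, Q.col_comm]
        exact hop i y x h1.symm h2 h3
  refine ⟨κ, φ.trans ⟨Sum.elim f z, hfz⟩, fun B hB => ?_⟩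
  obtain ⟨k, x, y, hxy, hBxy⟩ : B.map φ ∈ augmentedBlocks N := hφ ▸ Set.mem_image_of_mem _ hB
  obtain ⟨h1, h2⟩ := hadj k x y hxy
  have hfxy : f x ≠ f y := fun h =>
    hxy.ne (Sum.inl_injective (hfz (a₁ := .inl x) (a₂ := .inl y) h))
  obtain ⟨hblock, hc⟩ := hQ (f x) (f y) hfxy
  have hmap : B.map (φ.trans ⟨Sum.elim f z, hfz⟩) = {f x, f y, Q.op (f x) (f y)} := by
    rw [← map_map, hBxy, h1]
    simp
  rw [← h2, ← hc]
  exact ⟨hmap ▸ hblock, by congr 2⟩
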